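/- Let $\Omega\subset\mathbb R^2$ be bounded and open and let $\gamma:\Omega\to\mathbb R$ be continuous. Put $\Omega^+=\{x\in\Omega:\gamma(x)\ge 0\}$, $\Omega^-=\Omega\setminus\Omega^+$, $\Gamma=\{x\in\Omega:\gamma(x)=0\}$ (for example a smooth curve). Let $d\ge 0$ be an integer and let $f=f_1$ on $\Omega^+$, $f=f_2$ on $\Omega^-$, with $f_1\in C^{d+1}(\overline{\Omega^+})$, $f_2\in C^{d+1}(\overline{\Omega^-})$ (restrictions of $C^{d+1}$ functions on $\mathbb R^2$). Let $\omega:[0,\infty)\to[0,\infty)$ be nonincreasing with support size $c\ge 2$ (positive on $[0,c)$, zero on $(c,\infty)$) and $\omega(c-\varepsilon_0)\ge C_0>0$ for some $0<\varepsilon_0<c$. Let $k\ge 0$ satisfy $c\ge d/2+k$, let $t\ge d+1$ be real, and let $\rho,\sigma',\tau>0$ and $\sigma,\Lambda$ be real constants. Data dependent MLS (DD-MLS). Let $X\subset\Omega$ be a finite set of nodes, $h=\sup_{x\in\Omega}\min_{y\in X}\|x-y\|$ its fill distance, $\delta,\epsilon>0$, and let $\Pi_d$ be the space of bivariate polynomials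 of total degree at most $d$. The smoothness indicator $I_y$ of a node $y$ is the mean of $|f(z)-p_y(z)|$ over the nodes $z\in X$ with $\|z-y\|<\delta$, where $p_y\in\Pi_1$ is a least squares fit of $f$ at those nodes. The DD-MLS approximation of $f(x_0)$ is $\tilde p_{x_0}(x_0)$, where $$\tilde p_{x_0}=\operatorname*{argmin}_{p\in\Pi_d}\sum_{y\in X}(f(y)-p(y))^2\,\frac{\omega(\|y-x_0\|/h)}{(\epsilon+I_y)^t}.$$ Let $S(x_0)=\{y\in X:\omega(\|y-x_0\|/h)>0\}$. Call a node $y\in S(x_0)$ smooth if $I_y\le\sigma h^2$, and flagged otherwise. Then there is a constant $C$, depending only on the data of the first paragraph, such that for all $X,\delta,\epsilon$ and all $x_0\in\Omega^+$ at distance at least $ch-kh$ from $\Gamma$, the minimizer $\tilde p_{x_0}$ exists, is unique, and satisfies $$|f(x_0)-\tilde p_{x_0}(x_0)|\le C\,h^{d+1},$$ provided that: (a) distinct nodes are at distance at least $\rho h$ from each other; $\epsilon\le\sigma h^2$; and $\epsilon+I_y\ge\sigma' h^2$ for all $y\in S(x_0)$; (b) $\{x\in\Omega:\|x-x_0\|\le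 ch\}$ is star-shaped with respect to $x_0$ (automatic if $\Omega$ is convex); (c) every flagged node of $S(x_0)$ has $I_y\ge\tau$ and lies within distance $kh$ of $\Gamma$, and every node of $S(x_0)\cap\Omega^-$ within distance $kh$ of $\Gamma$ is flagged; (d) there are $\binom{d+2}{2}$ smooth nodes of $S(x_0)$ in $\Omega^+$, at distance at most $(c-\varepsilon_0)h$ from $x_0$, at which interpolation in $\Pi_d$ is well defined with operator norm at most $\Lambda$ (maximum norm of the nodal values, supremum norm on $\{x\in\Omega:\|x-x_0\|\le ch\}$). -/

import Mathlib

noncomputable section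

namespace DDMLS

/-- The Euclidean plane. -/
abbrev Plane : Type := EuclideanSpace ℝ (Fin 2)

/-- The space `Π_d(ℝ²)` of bivariate real polynomials of total degree at most `d`. -/
abbrev PolyLE (d : ℕ) : Submodule ℝ (MvPolynomial (Fin 2) ℝ) :=
  MvPolynomial.restrictTotalDegree (Fin 2) ℝ d

/-- The value of the polynomial `p` at the point `x` of the plane. -/
def peval (p : MvPolynomial (Fin 2) ℝ) (x : Plane) : ℝ :=
  MvPolynomial.eval (fun i => x i) p

/-! ### The domain, the discontinuity curve and the function -/

/-- `Ω⁺ = {x ∈ Ω : γ(x) ≥ 0}`. -/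
def plusSide (Ω : Set Plane) (γ : Plane → ℝ) : Set Plane := {x | x ∈ Ω ∧ 0 ≤ γ x}

/-- `Ω⁻ = Ω \ Ω⁺`. -/
def minusSide (Ω : Set Plane) (γ : Plane → ℝ) : Set Plane := Ω \ plusSide Ω γ

/-- `Γ`, the zero level set of `γ` in `Ω`. -/
def levelCurve (Ω : Set Plane) (γ : Plane → ℝ) : Set Plane := {x | x ∈ Ω ∧ γ x = 0}

/-- The function equal to `f₁` on `Ω⁺` and to `f₂` on `Ω⁻` (only its values on `Ω` matter). -/
def pieced (γ : Plane → ℝ) (f₁ f₂ : Plane → ℝ) (x : Plane) : ℝ :=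
  if 0 ≤ γ x then f₁ x else f₂ x

/-- `g ∈ C^m(closure A)`: on the closure of `A`, `g` is the restriction of a `C^m` function. -/
def SmoothUpTo (m : ℕ) (g : Plane → ℝ) (A : Set Plane) : Prop :=
  ∃ G : Plane → ℝ, ContDiff ℝ (m : WithTop ℕ∞) G ∧ Set.EqOn g G (closure A)

/-- Fill distance `sup_{x ∈ Ω} min_{y ∈ X} ‖x - y‖` of a (nonempty) finite set of nodes `X`
in a bounded domain `Ω`. -/
def fillDistance (Ω : Set Plane) (X : Finset Plane) : ℝ :=
  ⨆ x : Ω, Metric.infDist (x : Plane) (X : Set Plane)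

/-! ### Weighted least squares -/

/-- `p` minimizes `∑_{z ∈ S} (g(z) - p(z))² w(z)` over `Π_d`. -/
def IsLeastSquares (d : ℕ) (S : Finset Plane) (w g : Plane → ℝ)
    (p : MvPolynomial (Fin 2) ℝ) : Prop :=
  p ∈ PolyLE d ∧ ∀ q ∈ PolyLE d,
    ∑ z ∈ S, (g z - peval p z) ^ 2 * w z ≤ ∑ z ∈ S, (g z - peval q z) ^ 2 * w z

/-- Unweighted least squares fits exist. -/
theorem exists_isLeastSquares (d : ℕ) (S : Finset Plane) (g : Plane → ℝ) :
    ∃ p, IsLeastSquares d S (fun _ => 1) g p := by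
  classical
  let L : MvPolynomial (Fin 2) ℝ →ₗ[ℝ] EuclideanSpace ℝ S :=
    { toFun := fun p => WithLp.toLp 2 (fun z : S => peval p z)
      map_add' := fun p q => by ext z; simp [peval]
      map_smul' := fun r p => by ext z; simp [peval] }
  let K : Submodule ℝ (EuclideanSpace ℝ S) := (PolyLE d).map L
  let v : EuclideanSpace ℝ S := WithLp.toLp 2 (fun z : S => g z)
  have hsum : ∀ q : MvPolynomial (Fin 2) ℝ,
      ∑ z ∈ S, (g z - peval q z) ^ 2 * (1 : ℝ) = ‖v - L q‖ ^ 2 := by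
    intro q
    rw [EuclideanSpace.norm_sq_eq, ← Finset.sum_coe_sort S]
    refine Finset.sum_congr rfl fun z _ => ?_
    simp [v, L]
  obtain ⟨p, hp, hpL⟩ := Submodule.mem_map.1 (K.starProjection_apply_mem v)
  refine ⟨p, hp, fun q hq => ?_⟩
  have hmem : L q ∈ K := Submodule.mem_map_of_mem hq
  have hmin : ‖v - L p‖ ≤ ‖v - L q‖ := by
    rw [hpL, Submodule.starProjection_minimal]
    exact ciInf_le ⟨0, by rintro _ ⟨x, rfl⟩; exact norm_nonneg _⟩ (⟨L q, hmem⟩ : K)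
  rw [hsum, hsum]
  exact pow_le_pow_left₀ (norm_nonneg _) hmin 2

/-! ### Smoothness indicators -/

/-- The stencil `S(y) = B(y, δ) ∩ X`. -/
def stencil (X : Finset Plane) (δ : ℝ) (y : Plane) : Finset Plane :=
  open Classical in X.filter (fun z => z ∈ Metric.ball y δ)

/-- A linear least squares fit of the data on the stencil of `y`. (Its values at the nodes of the
stencil do not depend on the choice of the minimizer.) -/
def linearFit (f : Plane → ℝ) (X : Finset Plane) (δ : ℝ) (y : Plane) :
    MvPolynomial (Fin 2) ℝ :=
  Classical.choose (exists_isLeastSquares 1 (stencil X δ y) f)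

/-- The smoothness indicator: mean absolute residual of the linear least squares fit on the
stencil. -/
def indicator (f : Plane → ℝ) (X : Finset Plane) (δ : ℝ) (y : Plane) : ℝ :=
  (1 / ((stencil X δ y).card : ℝ)) *
    ∑ z ∈ stencil X δ y, |f z - peval (linearFit f X δ y) z|

/-! ### The data dependent MLS approximation -/

/-- The data dependent weight `ω(‖x₀ - y‖ / h) / (ε + I_y)^t` of the node `y`. -/
def ddWeight (ω : ℝ → ℝ) (h ε t : ℝ) (f : Plane → ℝ) (X : Finset Plane) (δ : ℝ)
    (x₀ y : Plane) : ℝ :=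
  ω (dist y x₀ / h) / (ε + indicator f X δ y) ^ t

/-- `p` is a solution of the data dependent MLS problem of degree `d` at `x₀`; the approximation
of `f(x₀)` is then `p(x₀)`. -/
def IsDDMLS (d : ℕ) (ω : ℝ → ℝ) (h ε t : ℝ) (f : Plane → ℝ) (X : Finset Plane) (δ : ℝ)
    (x₀ : Plane) (p : MvPolynomial (Fin 2) ℝ) : Prop :=
  IsLeastSquares d X (ddWeight ω h ε t f X δ x₀) f p

/-- The nodes that enter the approximation at `x₀`: those with `ω(‖y - x₀‖ / h) > 0`. -/
def supportNodes (ω : ℝ → ℝ) (h : ℝ) (X : Finset Plane) (x₀ : Plane) : Set Plane :=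
  {y | y ∈ X ∧ 0 < ω (dist y x₀ / h)}

/-- The nodes of the support with indicator of order `h²` (with constant `σ`). -/
def smoothNodes (σ : ℝ) (ω : ℝ → ℝ) (h : ℝ) (f : Plane → ℝ) (X : Finset Plane) (δ : ℝ)
    (x₀ : Plane) : Set Plane :=
  {y | y ∈ supportNodes ω h X x₀ ∧ indicator f X δ y ≤ σ * h ^ 2}

/-- The remaining nodes of the support: those flagged as nonsmooth (infected). -/
def flaggedNodes (σ : ℝ) (ω : ℝ → ℝ) (h : ℝ) (f : Plane → ℝ) (X : Finset Plane) (δ : ℝ)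
    (x₀ : Plane) : Set Plane :=
  supportNodes ω h X x₀ \ smoothNodes σ ω h f X δ x₀

/-- Interpolation in `Π_d` at the points of `P` is well defined, and the interpolation operator,
from the values at `P` with the maximum norm to the functions on `K` with the supremum norm, has
norm at most `Λ`. -/
def InterpolationBound (d : ℕ) (P : Finset Plane) (K : Set Plane) (Λ : ℝ) : Prop :=
  (∀ v : Plane → ℝ, ∃! q : MvPolynomial (Fin 2) ℝ,
      q ∈ PolyLE d ∧ ∀ z ∈ P, peval q z = v z) ∧
  ∀ q ∈ PolyLE d, ∀ B : ℝ, (∀ z ∈ P, |peval q z| ≤ B) → ∀ x ∈ K, |peval q x| ≤ Λ * B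

end DDMLS

end

open DDMLS

/-!
The order `h ^ (d + 1)` comes from comparing the minimizer `p` with the Taylor polynomial `q` of
degree `d` at `x₀` of the smooth extension of `f₁` (`exists_taylor_polynomial`).

A node of the support in `Ω⁻` is joined to `x₀` by a segment in `Ω`, which crosses `Γ`; since `x₀`
is at distance at least `(c - k) h` from `Γ`, the node is within `k h` of `Γ` and hence flagged
(`mem_plusSide_of_mem_smoothNodes`). So all smooth nodes lie in `Ω⁺`, where the residual of `q` is
`O(h ^ (d + 1))`; their weights are `O(h ^ (-2 t))`. At flagged nodes the residual of `q` and the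
weight are only `O(1)`. As the separation of the nodes bounds their number
(`exists_card_le_of_separated`), the functional at `q` is `O(h ^ (2 (d + 1) - 2 t) + 1)`
(`sum_residual_le`), and its value at `p` is no larger.

At the interpolation nodes `P` the weights are at least a constant times `h ^ (-2 t)`. Dividing by
them leaves `(f - p)² = O(h ^ (2 (d + 1)) + h ^ (2 t))` there, and `t ≥ d + 1` absorbs the second
term (`residual_scaling`). Thus `p - q = O(h ^ (d + 1))` on `P`, and the bound on the interpolation
operator carries this to `x₀`, where `q` equals `f`. Unisolvence of `P`, whose weights are positive,
also gives existence and uniqueness of the minimizer (`existsUnique_isLeastSquares`).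
-/

namespace DDMLS

/-! ### Taylor polynomials in the plane -/

theorem peval_sub (p q : MvPolynomial (Fin 2) ℝ) (x : Plane) :
    peval (p - q) x = peval p x - peval q x := by
  simp [peval]

/-- Expanding a `j`-linear form in coordinates: on the diagonal it is a polynomial of degree at
most `j`, here centred at `x₀`. -/
theorem exists_polyLE_peval_eq_multilinear {d j : ℕ} (hj : j ≤ d)
    (A : ContinuousMultilinearMap ℝ (fun _ : Fin j => Plane) ℝ) (x₀ : Plane) :
    ∃ q ∈ PolyLE d, ∀ x, peval q x = A (fun _ => x - x₀) := by
  classical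
  let e := EuclideanSpace.basisFun (Fin 2) ℝ
  refine ⟨∑ r : Fin j → Fin 2, MvPolynomial.C (A fun i => e (r i)) *
    ∏ i, (MvPolynomial.X (r i) - MvPolynomial.C (x₀ (r i))), ?_, fun x => ?_⟩
  · refine Submodule.sum_mem _ fun r _ => ?_
    rw [MvPolynomial.mem_restrictTotalDegree]
    refine (MvPolynomial.totalDegree_mul _ _).trans ?_
    rw [MvPolynomial.totalDegree_C, zero_add]
    refine (MvPolynomial.totalDegree_finsetProd _ _).trans ((Finset.sum_le_sum
      (g := fun _ => 1) fun i _ => ?_).trans (by simpa using hj))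
    refine (MvPolynomial.totalDegree_sub_C_le _ _).trans ?_
    simp
  · have hx : x - x₀ = ∑ i, (x - x₀) i • e i := by
      simpa [e] using ((EuclideanSpace.basisFun (Fin 2) ℝ).sum_repr (x - x₀)).symm
    conv_rhs => rw [hx]
    rw [A.map_sum]
    simp only [peval, map_sum, map_mul, map_prod, MvPolynomial.eval_C, map_sub,
      MvPolynomial.eval_X]
    refine Finset.sum_congr rfl fun r _ => ?_
    rw [A.map_smul_univ, smul_eq_mul, mul_comm]
    simp

theorem iteratedDeriv_comp_line {n : ℕ} {F : Plane → ℝ} (hF : ContDiff ℝ (n : WithTop ℕ∞) F)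
    {j : ℕ} (hj : j ≤ n) (x₀ v : Plane) (s : ℝ) :
    iteratedDeriv j (fun s : ℝ => F (x₀ + s • v)) s =
      iteratedFDeriv ℝ j F (x₀ + s • v) fun _ => v := by
  have h := ContinuousLinearMap.iteratedFDeriv_comp_right
    (ContinuousLinearMap.toSpanSingleton ℝ v) (f := fun y => F (x₀ + y))
    (n := (n : WithTop ℕ∞)) (hF.comp (contDiff_const.add contDiff_id)) s
    (i := j) (by exact_mod_cast hj)
  have h' : (fun s : ℝ => F (x₀ + s • v)) =
      (fun y => F (x₀ + y)) ∘ ContinuousLinearMap.toSpanSingleton ℝ v := by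
    ext; simp
  rw [iteratedDeriv_eq_iteratedFDeriv, h', h, iteratedFDeriv_comp_add_left]
  simp

/-- Taylor's theorem in the plane, with a remainder that is uniform over centres in a ball. -/
theorem exists_taylor_polynomial {d : ℕ} {F : Plane → ℝ}
    (hF : ContDiff ℝ ((d + 1 : ℕ) : WithTop ℕ∞) F) (R : ℝ) :
    ∃ M, 0 ≤ M ∧ ∀ x₀ ∈ Metric.closedBall (0 : Plane) R, ∃ p ∈ PolyLE d, peval p x₀ = F x₀ ∧
      ∀ x ∈ Metric.closedBall (0 : Plane) R, |F x - peval p x| ≤ M * dist x x₀ ^ (d + 1) := by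
  obtain ⟨M, hM⟩ := (isCompact_closedBall (0 : Plane) R).exists_bound_of_continuousOn
    (hF.continuous_iteratedFDeriv le_rfl).continuousOn
  refine ⟨max M 0, le_max_right _ _, fun x₀ hx₀ => ?_⟩
  have hq : ∀ j ∈ Finset.range (d + 1), ∃ q ∈ PolyLE d, ∀ x,
      peval q x = iteratedFDeriv ℝ j F x₀ (fun _ => x - x₀) := fun j hj =>
    exists_polyLE_peval_eq_multilinear (by have := Finset.mem_range.1 hj; omega) _ _
  choose! q hqd hqe using hq
  have key : ∀ x ∈ Metric.closedBall (0 : Plane) R,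
      |F x - peval (∑ j ∈ Finset.range (d + 1), ((j.factorial : ℝ)⁻¹) • q j) x|
        ≤ max M 0 * dist x x₀ ^ (d + 1) := by
    intro x hx
    set v := x - x₀ with hv
    have hline : ContDiff ℝ ((d + 1 : ℕ) : WithTop ℕ∞) (fun s : ℝ => F (x₀ + s • v)) :=
      hF.comp (contDiff_const.add (contDiff_id.smul contDiff_const))
    have hud : UniqueDiffOn ℝ (Set.Icc (0 : ℝ) 1) := uniqueDiffOn_Icc one_pos
    have hder : ∀ j ≤ d + 1, ∀ s ∈ Set.Icc (0 : ℝ) 1,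
        iteratedDerivWithin j (fun s : ℝ => F (x₀ + s • v)) (Set.Icc 0 1) s =
          iteratedFDeriv ℝ j F (x₀ + s • v) fun _ => v := fun j hj s hs => by
      rw [iteratedDerivWithin_eq_iteratedDeriv hud
        (hline.contDiffAt.of_le (by exact_mod_cast hj)) hs, iteratedDeriv_comp_line hF hj]
    have hbound := taylor_mean_remainder_bound (f := fun s : ℝ => F (x₀ + s • v)) (n := d)
      (C := max M 0 * ‖v‖ ^ (d + 1)) zero_le_one hline.contDiffOn
      (Set.right_mem_Icc.2 zero_le_one) (fun s hs => by
        rw [hder _ le_rfl s hs]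
        refine (ContinuousMultilinearMap.le_opNorm _ _).trans ?_
        rw [Finset.prod_const, Finset.card_univ, Fintype.card_fin]
        gcongr
        refine (hM _ ?_).trans (le_max_left _ _)
        have := (convex_closedBall (0 : Plane) R).add_smul_sub_mem hx₀ hx hs
        exact this)
    have htaylor : taylorWithinEval (fun s : ℝ => F (x₀ + s • v)) d (Set.Icc 0 1) 0 1 =
        peval (∑ j ∈ Finset.range (d + 1), ((j.factorial : ℝ)⁻¹) • q j) x := by
      rw [taylor_within_apply, peval, map_sum]
      refine Finset.sum_congr rfl fun j hj => ?_
      have h1 := hqe j hj x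
      rw [peval] at h1
      rw [hder j (Finset.mem_range.1 hj).le 0 (Set.left_mem_Icc.2 zero_le_one),
        MvPolynomial.smul_eval, h1]
      simp [hv]
    rw [htaylor, Real.norm_eq_abs] at hbound
    refine le_trans (le_of_eq ?_) (hbound.trans ?_)
    · simp [hv]
    · rw [sub_zero, one_pow, mul_one, dist_eq_norm]
      exact div_le_self (by positivity) (Nat.one_le_cast.2 d.factorial_pos)
  refine ⟨_, Submodule.sum_mem _ fun j hj => Submodule.smul_mem _ _ (hqd j hj), ?_, key⟩
  -- the remainder estimate at `x = x₀` reads `|F x₀ - p x₀| ≤ 0`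
  have := key x₀ hx₀
  rw [dist_self, zero_pow d.succ_ne_zero, mul_zero] at this
  exact (sub_eq_zero.1 (abs_nonpos_iff.1 this)).symm

/-! ### Counting separated nodes -/

/-- The number of `ρ h`-separated points in a ball of radius `c h` is bounded independently of
the scale `h` and of the centre. -/
theorem exists_card_le_of_separated (c : ℝ) {ρ : ℝ} (hρ : 0 < ρ) :
    ∃ N : ℕ, ∀ (h : ℝ) (x₀ : Plane) (Y : Finset Plane), 0 < h →
      (∀ y ∈ Y, dist y x₀ ≤ c * h) → (∀ y ∈ Y, ∀ z ∈ Y, y ≠ z → ρ * h ≤ dist y z) →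
      Y.card ≤ N := by
  obtain ⟨T, -, hT, hcov⟩ := Metric.totallyBounded_iff.1
    (isCompact_closedBall (0 : Plane) c).totallyBounded (ρ / 2) (by positivity) |>.imp
      fun T hT => (⟨trivial, hT⟩ : True ∧ _)
  refine ⟨hT.toFinset.card, fun h x₀ Y hh hY hsep => ?_⟩
  have hnear : ∀ y ∈ Y, ∃ a ∈ T, dist (h⁻¹ • (y - x₀)) a < ρ / 2 := fun y hy => by
    have hmem : h⁻¹ • (y - x₀) ∈ Metric.closedBall (0 : Plane) c := by
      rw [mem_closedBall_zero_iff, norm_smul, norm_inv, Real.norm_of_nonneg hh.le,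
        inv_mul_le_iff₀ hh, ← dist_eq_norm, mul_comm]
      exact hY y hy
    simpa using hcov hmem
  choose! a haT hda using hnear
  refine Finset.card_le_card_of_injOn a (fun y hy => by simpa using haT y hy) ?_
  intro y hy z hz hyz
  by_contra hne
  have h1 : dist (h⁻¹ • (y - x₀)) (h⁻¹ • (z - x₀)) < ρ :=
    calc _ ≤ dist (h⁻¹ • (y - x₀)) (a y) + dist (h⁻¹ • (z - x₀)) (a y) :=
          dist_triangle_right _ _ _
      _ < ρ / 2 + ρ / 2 := add_lt_add (hda y hy) (hyz ▸ hda z hz)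
      _ = ρ := add_halves ρ
  rw [dist_smul₀, dist_sub_right, norm_inv, Real.norm_of_nonneg hh.le, inv_mul_lt_iff₀ hh,
    mul_comm] at h1
  exact (hsep y hy z hz hne).not_gt h1

/-! ### Weighted least squares -/

/-- A minimizer is given by the orthogonal projection of the data, rescaled by `√w`, onto the
equally rescaled nodal values of polynomials. -/
theorem exists_isLeastSquares_of_nonneg (d : ℕ) (S : Finset Plane) (w g : Plane → ℝ)
    (hw : ∀ z ∈ S, 0 ≤ w z) : ∃ p, IsLeastSquares d S w g p := by
  classical
  let L : MvPolynomial (Fin 2) ℝ →ₗ[ℝ] EuclideanSpace ℝ S :=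
    { toFun := fun p => WithLp.toLp 2 (fun z : S => √(w z) * peval p z)
      map_add' := fun p q => by ext z; simp [peval, mul_add]
      map_smul' := fun r p => by ext z; simp [peval, mul_left_comm] }
  let K : Submodule ℝ (EuclideanSpace ℝ S) := (PolyLE d).map L
  let v : EuclideanSpace ℝ S := WithLp.toLp 2 (fun z : S => √(w z) * g z)
  have hsum : ∀ q : MvPolynomial (Fin 2) ℝ,
      ∑ z ∈ S, (g z - peval q z) ^ 2 * w z = ‖v - L q‖ ^ 2 := by
    intro q
    rw [EuclideanSpace.norm_sq_eq, ← Finset.sum_coe_sort S]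
    refine Finset.sum_congr rfl fun z _ => ?_
    simp only [v, L, LinearMap.coe_mk, AddHom.coe_mk, PiLp.sub_apply, ← mul_sub, norm_mul,
      mul_pow, Real.norm_eq_abs, sq_abs, Real.sq_sqrt (hw z z.2)]
    ring
  obtain ⟨p, hp, hpL⟩ := Submodule.mem_map.1 (K.starProjection_apply_mem v)
  refine ⟨p, hp, fun q hq => ?_⟩
  have hmin : ‖v - L p‖ ≤ ‖v - L q‖ := by
    rw [hpL, Submodule.starProjection_minimal]
    exact ciInf_le ⟨0, by rintro _ ⟨x, rfl⟩; exact norm_nonneg _⟩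
      (⟨L q, Submodule.mem_map_of_mem hq⟩ : K)
  rw [hsum, hsum]
  exact pow_le_pow_left₀ (norm_nonneg _) hmin 2

/-- Two minimizers agree wherever the weight is positive, by strict convexity: the parallelogram
identity for their midpoint forces the weighted sum of squared differences to vanish. -/
theorem IsLeastSquares.peval_eq {d : ℕ} {S : Finset Plane} {w g : Plane → ℝ}
    {p q : MvPolynomial (Fin 2) ℝ} (hw : ∀ z ∈ S, 0 ≤ w z) (hp : IsLeastSquares d S w g p)
    (hq : IsLeastSquares d S w g q) {z : Plane} (hz : z ∈ S) (hwz : 0 < w z) :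
    peval p z = peval q z := by
  set m := (1 / 2 : ℝ) • (p + q)
  have hm : m ∈ PolyLE d := Submodule.smul_mem _ _ (Submodule.add_mem _ hp.1 hq.1)
  have hmz : ∀ x, peval m x = (peval p x + peval q x) / 2 := fun x => by
    simp [m, peval, MvPolynomial.smul_eval]; ring
  have hid : ∑ x ∈ S, (peval p x - peval q x) ^ 2 * w x =
      2 * (∑ x ∈ S, (g x - peval p x) ^ 2 * w x) + 2 * (∑ x ∈ S, (g x - peval q x) ^ 2 * w x)
        - 4 * ∑ x ∈ S, (g x - peval m x) ^ 2 * w x := by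
    simp only [Finset.mul_sum, ← Finset.sum_add_distrib, ← Finset.sum_sub_distrib, hmz]
    exact Finset.sum_congr rfl fun x _ => by ring
  have hle := Finset.single_le_sum (f := fun x => (peval p x - peval q x) ^ 2 * w x)
    (fun x hx => mul_nonneg (sq_nonneg _) (hw x hx)) hz
  have h0 : (peval p z - peval q z) ^ 2 * w z ≤ 0 := by
    have := hp.2 m hm
    have := hq.2 m hm
    linarith
  exact sub_eq_zero.1 (pow_eq_zero_iff two_ne_zero |>.1
    (le_antisymm (nonpos_of_mul_nonpos_left h0 hwz) (sq_nonneg _)))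

/-- With positive weights at a unisolvent set of nodes, the minimizer exists and is unique. -/
theorem existsUnique_isLeastSquares {d : ℕ} {S P : Finset Plane} {w g : Plane → ℝ}
    {K : Set Plane} {Λ : ℝ} (hw : ∀ z ∈ S, 0 ≤ w z) (hPS : P ⊆ S) (hPw : ∀ z ∈ P, 0 < w z)
    (hP : InterpolationBound d P K Λ) : ∃! p, IsLeastSquares d S w g p := by
  obtain ⟨p, hp⟩ := exists_isLeastSquares_of_nonneg d S w g hw
  refine ⟨p, hp, fun q hq => ?_⟩
  exact (hP.1 (peval p)).unique ⟨hq.1, fun z hz => hq.peval_eq hw hp (hPS hz) (hPw z hz)⟩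
    ⟨hp.1, fun _ _ => rfl⟩

/-- The weighted residual of the minimizer at one node is at most the total weighted residual of
any competitor. -/
theorem IsLeastSquares.residual_le {d : ℕ} {S : Finset Plane} {w g : Plane → ℝ}
    {p q : MvPolynomial (Fin 2) ℝ} (hw : ∀ z ∈ S, 0 ≤ w z) (hp : IsLeastSquares d S w g p)
    (hq : q ∈ PolyLE d) {z : Plane} (hz : z ∈ S) :
    (g z - peval p z) ^ 2 * w z ≤ ∑ x ∈ S, (g x - peval q x) ^ 2 * w x :=
  (Finset.single_le_sum (f := fun x => (g x - peval p x) ^ 2 * w x)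
    (fun x hx => mul_nonneg (sq_nonneg _) (hw x hx)) hz).trans (hp.2 q hq)

/-! ### The geometry of the support -/

theorem fillDistance_nonneg (Ω : Set Plane) (X : Finset Plane) : 0 ≤ fillDistance Ω X :=
  Real.iSup_nonneg fun _ => Metric.infDist_nonneg

/-- `Metric.infDist` vanishes for an empty set of nodes, but here a node is given; the supremum is
then bounded by the diameter of `Ω`. -/
theorem fillDistance_le {Ω : Set Plane} {X : Finset Plane} {R : ℝ} {y : Plane} (hy : y ∈ X)
    (hX : y ∈ Ω) (hR : Ω ⊆ Metric.closedBall 0 R) : fillDistance Ω X ≤ 2 * R := by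
  have : Nonempty Ω := ⟨⟨y, hX⟩⟩
  refine ciSup_le fun x => (Metric.infDist_le_dist_of_mem (Finset.mem_coe.2 hy)).trans ?_
  have h1 := Metric.mem_closedBall.1 (hR x.2)
  have h2 := Metric.mem_closedBall.1 (hR hX)
  linarith [dist_triangle_right (x : Plane) y 0]

/-- A point of `Ω⁻` that sees `x₀ ∈ Ω⁺` at distance at most `r` is within `r - s` of `Γ` when `x₀`
is at distance at least `s` from `Γ`: the segment between them crosses `Γ`. -/
theorem mem_cthickening_levelCurve {Ω : Set Plane} {γ : Plane → ℝ} (hγ : ContinuousOn γ Ω)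
    {x₀ y : Plane} {r s : ℝ} (hx₀ : x₀ ∈ plusSide Ω γ) (hy : y ∈ minusSide Ω γ)
    (hseg : segment ℝ x₀ y ⊆ Ω) (hr : dist y x₀ ≤ r)
    (hs : x₀ ∉ Metric.thickening s (levelCurve Ω γ)) :
    y ∈ Metric.cthickening (r - s) (levelCurve Ω γ) := by
  have hγy : γ y < 0 := by
    by_contra h
    exact hy.2 ⟨hy.1, not_lt.1 h⟩
  obtain ⟨z, hz, hz0⟩ := (convex_segment (𝕜 := ℝ) x₀ y).isPreconnected.intermediate_value
    (right_mem_segment ℝ x₀ y) (left_mem_segment ℝ x₀ y) (hγ.mono hseg)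
    (⟨hγy.le, hx₀.2⟩ : (0 : ℝ) ∈ Set.Icc (γ y) (γ x₀))
  have hzΓ : z ∈ levelCurve Ω γ := ⟨hseg hz, hz0⟩
  have h1 : s ≤ dist x₀ z := by
    by_contra h
    exact hs (Metric.mem_thickening_iff.2 ⟨z, hzΓ, not_le.1 h⟩)
  have h2 := dist_add_dist_of_mem_segment hz
  refine Metric.mem_cthickening_of_dist_le y z _ _ hzΓ ?_
  rw [dist_comm y x₀] at hr
  rw [dist_comm y z]
  linarith

theorem dist_le_of_mem_supportNodes {ω : ℝ → ℝ} {h c : ℝ} {X : Finset Plane} {x₀ y : Plane}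
    (hω : ∀ r, c < r → ω r = 0) (hh : 0 < h) (hy : y ∈ supportNodes ω h X x₀) :
    dist y x₀ ≤ c * h := by
  by_contra hlt
  exact hy.2.ne' (hω _ ((lt_div_iff₀ hh).2 (not_le.1 hlt)))

/-- A smooth node lies in `Ω⁺`: a node of the support in `Ω⁻` is within `k h` of `Γ`, where all
nodes of `Ω⁻` are flagged. -/
theorem mem_plusSide_of_mem_smoothNodes {Ω : Set Plane} {γ : Plane → ℝ} (hγ : ContinuousOn γ Ω)
    {σ c k h δ : ℝ} {ω : ℝ → ℝ} {f : Plane → ℝ} {X : Finset Plane} {x₀ y : Plane}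
    (hω : ∀ r, c < r → ω r = 0) (hh : 0 < h) (hX : ∀ y ∈ X, y ∈ Ω) (hx₀ : x₀ ∈ plusSide Ω γ)
    (hdist : x₀ ∉ Metric.thickening (c * h - k * h) (levelCurve Ω γ))
    (hstar : StarConvex ℝ x₀ (Ω ∩ Metric.closedBall x₀ (c * h)))
    (hflag : supportNodes ω h X x₀ ∩ minusSide Ω γ ∩ Metric.cthickening (k * h) (levelCurve Ω γ) ⊆
      flaggedNodes σ ω h f X δ x₀)
    (hy : y ∈ smoothNodes σ ω h f X δ x₀) : y ∈ plusSide Ω γ := by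
  by_contra hplus
  have hyΩ := hX y hy.1.1
  have hyc := dist_le_of_mem_supportNodes hω hh hy.1
  have hseg : segment ℝ x₀ y ⊆ Ω :=
    (starConvex_iff_segment_subset.1 hstar ⟨hyΩ, hyc⟩).trans Set.inter_subset_left
  have hmem := mem_cthickening_levelCurve hγ hx₀ ⟨hyΩ, hplus⟩ hseg hyc hdist
  rw [sub_sub_cancel] at hmem
  exact (hflag ⟨⟨hy.1, hyΩ, hplus⟩, hmem⟩).2 hy

/-! ### Data dependent weights -/

theorem indicator_nonneg (f : Plane → ℝ) (X : Finset Plane) (δ : ℝ) (y : Plane) :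
    0 ≤ indicator f X δ y := by
  unfold indicator
  positivity

theorem ddWeight_nonneg {ω : ℝ → ℝ} {h ε t δ : ℝ} {f : Plane → ℝ} {X : Finset Plane}
    (hω : ∀ r, 0 ≤ r → 0 ≤ ω r) (hh : 0 ≤ h) (hε : 0 ≤ ε) (x₀ y : Plane) :
    0 ≤ ddWeight ω h ε t f X δ x₀ y :=
  div_nonneg (hω _ (by positivity))
    (Real.rpow_nonneg (add_nonneg hε (indicator_nonneg f X δ y)) t)

theorem ddWeight_le {ω : ℝ → ℝ} {h ε t δ a : ℝ} {f : Plane → ℝ} {X : Finset Plane}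
    (hω : AntitoneOn ω (Set.Ici 0)) (hω0 : 0 ≤ ω 0) (hh : 0 ≤ h) (ht : 0 ≤ t) {x₀ y : Plane}
    (ha : 0 < a) (hay : a ≤ ε + indicator f X δ y) :
    ddWeight ω h ε t f X δ x₀ y ≤ ω 0 / a ^ t :=
  div_le_div₀ hω0 (hω Set.self_mem_Ici (Set.mem_Ici.2 (by positivity)) (by positivity))
    (Real.rpow_pos_of_pos ha t) (Real.rpow_le_rpow ha.le hay ht)

theorem le_ddWeight {ω : ℝ → ℝ} {h ε t δ b r : ℝ} {f : Plane → ℝ} {X : Finset Plane}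
    (hω : AntitoneOn ω (Set.Ici 0)) (hωr : 0 ≤ ω r) (hh : 0 < h) (ht : 0 ≤ t) (hε : 0 < ε)
    {x₀ y : Plane} (hy : dist y x₀ ≤ r * h) (hb : ε + indicator f X δ y ≤ b) :
    ω r / b ^ t ≤ ddWeight ω h ε t f X δ x₀ y := by
  have h0 : 0 < ε + indicator f X δ y := add_pos_of_pos_of_nonneg hε (indicator_nonneg f X δ y)
  have h1 : 0 ≤ dist y x₀ / h := by positivity
  have h2 : dist y x₀ / h ≤ r := (div_le_iff₀ hh).2 hy
  have h3 : ω r ≤ ω (dist y x₀ / h) := hω h1 (Set.mem_Ici.2 (h1.trans h2)) h2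
  exact div_le_div₀ (hωr.trans h3) h3 (Real.rpow_pos_of_pos h0 t) (Real.rpow_le_rpow h0.le hb ht)

/-! ### Bounds on the data -/

theorem SmoothUpTo.exists_bound {m : ℕ} {g : Plane → ℝ} {A : Set Plane} (hg : SmoothUpTo m g A)
    (hA : Bornology.IsBounded A) : ∃ B, ∀ x ∈ A, |g x| ≤ B := by
  obtain ⟨G, hG, hGg⟩ := hg
  obtain ⟨B, hB⟩ := hA.isCompact_closure.exists_bound_of_continuousOn hG.continuous.continuousOn
  exact ⟨B, fun x hx => by
    rw [hGg (subset_closure hx)]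
    exact hB x (subset_closure hx)⟩

theorem exists_bound_pieced {Ω : Set Plane} {γ f₁ f₂ : Plane → ℝ} {m : ℕ}
    (hΩ : Bornology.IsBounded Ω) (hf₁ : SmoothUpTo m f₁ (plusSide Ω γ))
    (hf₂ : SmoothUpTo m f₂ (minusSide Ω γ)) : ∃ B, ∀ x ∈ Ω, |pieced γ f₁ f₂ x| ≤ B := by
  obtain ⟨B₁, hB₁⟩ := hf₁.exists_bound (hΩ.subset fun x hx => hx.1)
  obtain ⟨B₂, hB₂⟩ := hf₂.exists_bound (hΩ.subset fun x hx => hx.1)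
  refine ⟨max B₁ B₂, fun x hx => ?_⟩
  unfold pieced
  split_ifs with h
  · exact (hB₁ x ⟨hx, h⟩).trans (le_max_left _ _)
  · exact (hB₂ x ⟨hx, fun h' => h h'.2⟩).trans (le_max_right _ _)

/-! ### Residuals in the data dependent functional -/

/-- The weighted residual of a polynomial `q` in the data dependent MLS functional: smooth nodes
have small residuals and weights of order `h⁻²ᵗ`, flagged nodes have bounded residuals and
bounded weights. -/
theorem sum_residual_le {σ σ' τ c h ε t δ A B : ℝ} {d N : ℕ} {ω : ℝ → ℝ} {f : Plane → ℝ}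
    {X : Finset Plane} {x₀ : Plane} {q : MvPolynomial (Fin 2) ℝ}
    (hω_nonneg : ∀ r, 0 ≤ r → 0 ≤ ω r) (hω_anti : AntitoneOn ω (Set.Ici 0))
    (hω_zero : ∀ r, c < r → ω r = 0) (hh : 0 < h) (hε : 0 < ε) (ht : 0 ≤ t)
    (hσ' : 0 < σ') (hτ : 0 < τ)
    (hcard : ∀ Y ⊆ X, (∀ y ∈ Y, dist y x₀ ≤ c * h) → Y.card ≤ N)
    (hlow : ∀ y ∈ supportNodes ω h X x₀, σ' * h ^ 2 ≤ ε + indicator f X δ y)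
    (hflag : ∀ y ∈ flaggedNodes σ ω h f X δ x₀, τ ≤ indicator f X δ y)
    (hsm : ∀ y ∈ smoothNodes σ ω h f X δ x₀, |f y - peval q y| ≤ A * h ^ (d + 1))
    (hB : ∀ y ∈ X, |f y - peval q y| ≤ B) :
    ∑ y ∈ X, (f y - peval q y) ^ 2 * ddWeight ω h ε t f X δ x₀ y ≤
      N * ((A * h ^ (d + 1)) ^ 2 * (ω 0 / (σ' * h ^ 2) ^ t) + B ^ 2 * (ω 0 / τ ^ t)) := by
  classical
  have hω0 := hω_nonneg 0 le_rfl
  set T := (A * h ^ (d + 1)) ^ 2 * (ω 0 / (σ' * h ^ 2) ^ t) + B ^ 2 * (ω 0 / τ ^ t)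
  have h1 : 0 ≤ (A * h ^ (d + 1)) ^ 2 * (ω 0 / (σ' * h ^ 2) ^ t) := by positivity
  have h2 : 0 ≤ B ^ 2 * (ω 0 / τ ^ t) := by positivity
  have hT : 0 ≤ T := add_nonneg h1 h2
  have hle : ∀ y ∈ X, y ∈ supportNodes ω h X x₀ →
      (f y - peval q y) ^ 2 * ddWeight ω h ε t f X δ x₀ y ≤ T := by
    intro y hyX hy
    by_cases hys : y ∈ smoothNodes σ ω h f X δ x₀
    · refine le_trans ?_ (le_add_of_nonneg_right h2)
      exact mul_le_mul (sq_le_sq' (abs_le.1 (hsm y hys)).1 (abs_le.1 (hsm y hys)).2)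
        (ddWeight_le hω_anti hω0 hh.le ht (by positivity) (hlow y hy))
        (ddWeight_nonneg hω_nonneg hh.le hε.le _ _) (sq_nonneg _)
    · refine le_trans ?_ (le_add_of_nonneg_left h1)
      exact mul_le_mul (sq_le_sq' (abs_le.1 (hB y hyX)).1 (abs_le.1 (hB y hyX)).2)
        (ddWeight_le hω_anti hω0 hh.le ht hτ
          (by linarith [hflag y ⟨hy, hys⟩]))
        (ddWeight_nonneg hω_nonneg hh.le hε.le _ _) (sq_nonneg _)
  have hzero : ∀ y ∈ X, y ∉ supportNodes ω h X x₀ →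
      (f y - peval q y) ^ 2 * ddWeight ω h ε t f X δ x₀ y = 0 := by
    intro y hyX hy
    have : ω (dist y x₀ / h) = 0 :=
      le_antisymm (not_lt.1 fun hpos => hy ⟨hyX, hpos⟩) (hω_nonneg _ (by positivity))
    simp [ddWeight, this]
  rw [← Finset.sum_filter_of_ne (p := (· ∈ supportNodes ω h X x₀))
    fun y hy hne => not_not.1 fun hns => hne (hzero y hy hns)]
  refine (Finset.sum_le_card_nsmul _ _ T fun y hy =>
    hle y (Finset.mem_filter.1 hy).1 (Finset.mem_filter.1 hy).2).trans ?_
  rw [nsmul_eq_mul]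
  refine mul_le_mul_of_nonneg_right (Nat.cast_le.2 (hcard _ (Finset.filter_subset _ _)
    fun y hy => ?_)) hT
  exact dist_le_of_mem_supportNodes hω_zero hh (Finset.mem_filter.1 hy).2

/-- Dividing the total residual by the weight `C₀ / (2 σ h²)ᵗ` of a good node leaves a bound of
order `h²⁽ᵈ⁺¹⁾`; this is where `t ≥ d + 1` is used. -/
theorem residual_scaling {σ σ' τ t h D A B C₀ W N : ℝ} {d : ℕ} (ht : (d : ℝ) + 1 ≤ t)
    (hσ : 0 < σ) (hσ' : 0 < σ') (hτ : 0 < τ) (hC₀ : 0 < C₀) (hW : 0 ≤ W) (hN : 0 ≤ N)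
    (hh : 0 < h) (hhD : h ≤ D) :
    N * ((A * h ^ (d + 1)) ^ 2 * (W / (σ' * h ^ 2) ^ t) + B ^ 2 * (W / τ ^ t)) /
        (C₀ / (2 * σ * h ^ 2) ^ t) ≤
      N * (2 * σ) ^ t / C₀ *
        (A ^ 2 * (W / σ' ^ t) + B ^ 2 * (W / τ ^ t) * (D ^ 2) ^ (t - (d + 1))) *
        (h ^ (d + 1)) ^ 2 := by
  have hu : 0 < (h ^ 2) ^ t := by positivity
  have hsplit : (h ^ 2) ^ t ≤ (D ^ 2) ^ (t - (d + 1)) * (h ^ (d + 1)) ^ 2 := by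
    -- the surplus exponent `t - (d + 1)` is nonnegative and falls on the bounded quantity `h ≤ D`
    have h1 : (h ^ 2) ^ t = (h ^ 2) ^ (t - (d + 1)) * (h ^ (d + 1)) ^ 2 := by
      rw [← pow_mul, mul_comm (d + 1) 2, pow_mul, ← Real.rpow_natCast (h ^ 2) (d + 1),
        ← Real.rpow_add (by positivity)]
      push_cast
      ring_nf
    rw [h1]
    gcongr
  rw [Real.mul_rpow hσ'.le (by positivity), Real.mul_rpow (by positivity) (by positivity)]
  have hs : 0 < σ' ^ t := by positivity
  have hs2 : 0 < (2 * σ) ^ t := by positivity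
  have ht2 : 0 < τ ^ t := by positivity
  calc _ = N * (2 * σ) ^ t / C₀ *
        (A ^ 2 * (W / σ' ^ t) * (h ^ (d + 1)) ^ 2 + B ^ 2 * (W / τ ^ t) * (h ^ 2) ^ t) := by
        field_simp
    _ ≤ N * (2 * σ) ^ t / C₀ * (A ^ 2 * (W / σ' ^ t) * (h ^ (d + 1)) ^ 2 +
          B ^ 2 * (W / τ ^ t) * ((D ^ 2) ^ (t - (d + 1)) * (h ^ (d + 1)) ^ 2)) := by
        gcongr
    _ = _ := by ring

end DDMLS

/-! ### The approximation order -/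

theorem theorem4
    -- the domain, the discontinuity curve and the function
    (Ω : Set Plane) (hΩ : IsOpen Ω) (hΩb : Bornology.IsBounded Ω)
    (γ : Plane → ℝ) (hγ : ContinuousOn γ Ω)
    (d : ℕ) (f₁ f₂ : Plane → ℝ)
    (hf₁ : SmoothUpTo (d + 1) f₁ (plusSide Ω γ))
    (hf₂ : SmoothUpTo (d + 1) f₂ (minusSide Ω γ))
    -- the radial weight function, of support size `c`
    (ω : ℝ → ℝ) (c ε₀ C₀ : ℝ) (hc : 2 ≤ c)
    (hω_nonneg : ∀ r, 0 ≤ r → 0 ≤ ω r)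
    (hω_anti : AntitoneOn ω (Set.Ici 0))
    (hω_pos : ∀ r, 0 ≤ r → r < c → 0 < ω r)
    (hω_zero : ∀ r, c < r → ω r = 0)
    (hε₀ : 0 < ε₀) (hε₀c : ε₀ < c) (hC₀ : 0 < C₀) (hωC₀ : C₀ ≤ ω (c - ε₀))
    -- the exponent and the relation between support size, degree and flagged band
    (t : ℝ) (ht : (d : ℝ) + 1 ≤ t)
    (k : ℝ) (hk : 0 ≤ k) (hck : (d : ℝ) / 2 + k ≤ c)
    -- constants independent of the nodes and of the point
    (ρ σ σ' τ Λ : ℝ) (hρ : 0 < ρ) (hσ' : 0 < σ') (hτ : 0 < τ) :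
    ∃ C : ℝ, ∀ (X : Finset Plane) (h δ ε : ℝ) (x₀ : Plane),
      -- quasi-equally spaced nodes with fill distance `h`
      (∀ y ∈ X, y ∈ Ω) →
      h = fillDistance Ω X →
      (∀ y ∈ X, ∀ z ∈ X, y ≠ z → ρ * h ≤ dist y z) →
      -- stencil radius and regularization parameter
      0 < δ → 0 < ε → ε ≤ σ * h ^ 2 →
      (∀ y ∈ supportNodes ω h X x₀, σ' * h ^ 2 ≤ ε + indicator (pieced γ f₁ f₂) X δ y) →
      -- the point: in `Ω⁺`, at distance at least `ch - kh` from `Γ`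
      x₀ ∈ plusSide Ω γ →
      x₀ ∉ Metric.thickening (c * h - k * h) (levelCurve Ω γ) →
      StarConvex ℝ x₀ (Ω ∩ Metric.closedBall x₀ (c * h)) →
      -- flagged nodes: their indicators do not tend to `0`, they lie within distance `kh` of `Γ`,
      -- and the nodes of the support beyond `Γ` that lie in this band are flagged
      (∀ y ∈ flaggedNodes σ ω h (pieced γ f₁ f₂) X δ x₀, τ ≤ indicator (pieced γ f₁ f₂) X δ y) →
      flaggedNodes σ ω h (pieced γ f₁ f₂) X δ x₀ ⊆
        Metric.cthickening (k * h) (levelCurve Ω γ) →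
      supportNodes ω h X x₀ ∩ minusSide Ω γ ∩ Metric.cthickening (k * h) (levelCurve Ω γ) ⊆
        flaggedNodes σ ω h (pieced γ f₁ f₂) X δ x₀ →
      -- enough unflagged nodes in `Ω⁺`, with bounded interpolation operator
      (∃ P : Finset Plane, P.card = (d + 2).choose 2 ∧
        (∀ y ∈ P, y ∈ smoothNodes σ ω h (pieced γ f₁ f₂) X δ x₀ ∧ y ∈ plusSide Ω γ ∧
          dist y x₀ ≤ (c - ε₀) * h) ∧
        InterpolationBound d P (Ω ∩ Metric.closedBall x₀ (c * h)) Λ) →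
      (∃! p, IsDDMLS d ω h ε t (pieced γ f₁ f₂) X δ x₀ p) ∧
      ∀ p, IsDDMLS d ω h ε t (pieced γ f₁ f₂) X δ x₀ p →
        |pieced γ f₁ f₂ x₀ - peval p x₀| ≤ C * h ^ (d + 1) := by

  obtain ⟨F, hF, hFf⟩ := hf₁
  obtain ⟨R, hR⟩ := hΩb.subset_closedBall (0 : Plane)
  obtain ⟨M, hM, htaylor⟩ := exists_taylor_polynomial hF R
  obtain ⟨B, hB⟩ := exists_bound_pieced hΩb ⟨F, hF, hFf⟩ hf₂
  obtain ⟨B₁, hB₁⟩ := (isCompact_closedBall (0 : Plane) R).exists_bound_of_continuousOn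
    hF.continuous.continuousOn
  obtain ⟨N, hN⟩ := exists_card_le_of_separated c hρ
  set f := pieced γ f₁ f₂
  have hfF : ∀ x ∈ plusSide Ω γ, f x = F x := fun x hx =>
    (if_pos hx.2).trans (hFf (subset_closure hx))
  have ht0 : 0 ≤ t := le_trans (by positivity) ht
  -- the residual of a Taylor polynomial at an arbitrary node
  set B₂ := B + B₁ + M * (2 * R) ^ (d + 1)
  -- the residuals of the minimizer at the interpolation nodes are at most `√Q * h ^ (d + 1)`; nothing is
  -- assumed on the sign of `σ`, which is positive as soon as there is an admissible `ε`
  set Q := N * (2 * σ) ^ t / C₀ * ((M * c ^ (d + 1)) ^ 2 * (ω 0 / σ' ^ t) +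
    B₂ ^ 2 * (ω 0 / τ ^ t) * ((2 * R) ^ 2) ^ (t - (d + 1)))
  refine ⟨Λ * (√Q + M * c ^ (d + 1)), fun X h δ ε x₀ hX hfill hsep _ hε hεσ hlow hx₀ hdist hstar
    hflagτ _ hflag ⟨P, hPcard, hP, hPΛ⟩ => ?_⟩
  -- `h = 0` is excluded by `0 < ε ≤ σ h²`, which also forces `σ > 0`
  have hh : 0 < h := by
    refine lt_of_le_of_ne (hfill ▸ fillDistance_nonneg Ω X) fun h0 => ?_
    rw [← h0] at hεσ
    norm_num at hεσ
    linarith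
  have hσ : 0 < σ := pos_of_mul_pos_left (hε.trans_le hεσ) (sq_nonneg h)
  have hPX : P ⊆ X := fun y hy => (hP y hy).1.1.1
  have hhD : h ≤ 2 * R := by
    obtain ⟨y, hy⟩ : P.Nonempty := Finset.card_pos.1 (hPcard ▸ Nat.choose_pos (by omega))
    exact hfill ▸ fillDistance_le (hPX hy) (hX y (hPX hy)) hR
  set w := ddWeight ω h ε t f X δ x₀
  have hw : ∀ z, 0 ≤ w z := fun z => ddWeight_nonneg hω_nonneg hh.le hε.le x₀ z
  have hwP : ∀ z ∈ P, C₀ / (2 * σ * h ^ 2) ^ t ≤ w z := fun z hz => by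
    refine le_trans ?_ (le_ddWeight (b := 2 * σ * h ^ 2) hω_anti (hC₀.le.trans hωC₀) hh ht0 hε
      (hP z hz).2.2 (by linarith [(hP z hz).1.2]))
    gcongr
  have hpos : 0 < C₀ / (2 * σ * h ^ 2) ^ t := by positivity
  refine ⟨existsUnique_isLeastSquares (fun z _ => hw z) hPX (fun z hz => hpos.trans_le (hwP z hz))
    hPΛ, fun p hp => ?_⟩
  obtain ⟨q, hq, hqx₀, hqF⟩ := htaylor x₀ (hR hx₀.1)
  -- the Taylor polynomial at the nodes of `Ω⁺` in the support
  have hplus : ∀ y ∈ plusSide Ω γ, dist y x₀ ≤ c * h →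
      |f y - peval q y| ≤ M * c ^ (d + 1) * h ^ (d + 1) := fun y hy hyc => by
    rw [hfF y hy, mul_assoc, ← mul_pow]
    refine (hqF y (hR hy.1)).trans ?_
    gcongr
  have hall : ∀ y ∈ X, |f y - peval q y| ≤ B₂ := fun y hy => by
    have hyR := hR (hX y hy)
    have hdx : dist y x₀ ≤ 2 * R := by
      have h1 := Metric.mem_closedBall.1 hyR
      have h2 := Metric.mem_closedBall.1 (hR hx₀.1)
      linarith [dist_triangle_right y x₀ 0]
    have h1 : |F y - peval q y| ≤ M * (2 * R) ^ (d + 1) :=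
      (hqF y hyR).trans (by gcongr)
    have h2 : |f y - F y| ≤ B + B₁ :=
      (abs_sub _ _).trans (add_le_add (hB y (hX y hy)) (hB₁ y hyR))
    exact (abs_sub_le _ (F y) _).trans (add_le_add h2 h1)
  have hsum := sum_residual_le (σ := σ) (q := q) (d := d) (N := N) (A := M * c ^ (d + 1))
    (B := B₂) hω_nonneg hω_anti hω_zero hh hε ht0 hσ' hτ
    (fun Y hY hYc => hN h x₀ Y hh hYc fun y hy z hz => hsep y (hY hy) z (hY hz)) hlow hflagτ
    (fun y hy => hplus y
      (mem_plusSide_of_mem_smoothNodes hγ hω_zero hh hX hx₀ hdist hstar hflag hy)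
      (dist_le_of_mem_supportNodes hω_zero hh hy.1)) hall
  have hres : ∀ y ∈ P, |f y - peval p y| ≤ √Q * h ^ (d + 1) := fun y hy => by
    have h1 : (f y - peval p y) ^ 2 * (C₀ / (2 * σ * h ^ 2) ^ t) ≤ _ :=
      (mul_le_mul_of_nonneg_left (hwP y hy) (sq_nonneg _)).trans
        ((IsLeastSquares.residual_le (fun z _ => hw z) hp hq (hPX hy)).trans hsum)
    have h2 := ((le_div_iff₀ hpos).2 h1).trans (residual_scaling (D := 2 * R) ht hσ hσ' hτ hC₀
      (hω_nonneg 0 le_rfl) (Nat.cast_nonneg N) hh hhD)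
    refine (Real.abs_le_sqrt h2).trans_eq ?_
    rw [Real.sqrt_mul' _ (sq_nonneg _), Real.sqrt_sq (by positivity)]
  have hqp := hPΛ.2 (q - p) (Submodule.sub_mem _ hq hp.1)
    ((√Q + M * c ^ (d + 1)) * h ^ (d + 1)) (fun y hy => by
      have hyc : dist y x₀ ≤ c * h := (hP y hy).2.2.trans (by nlinarith)
      rw [peval_sub, add_mul, add_comm]
      refine (abs_sub_le _ (f y) _).trans (add_le_add ?_ (hres y hy))
      rw [abs_sub_comm]
      exact hplus y (hP y hy).2.1 hyc) x₀
    ⟨hx₀.1, Metric.mem_closedBall_self (by positivity)⟩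
  rw [peval_sub, hqx₀, ← hfF x₀ hx₀] at hqp
  exact hqp.trans_eq (mul_assoc _ _ _).symm
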